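/- Let $d\ge 2$ be an integer and let $f_{c,d}(x)=x^d+c$, where $c$ is an indeterminate. Write $f_{c,d}^k$ for the $k$-th iterate, with $f_{c,d}^0(x)=x$, so that $f_{c,d}^k(0)\in\mathbb{Z}[c]$, and let $\mu$ be the Möbius function. For integers $m,n\ge 1$ set $$F_{d,m,n}(c)=\prod_{k\mid n}\left(\frac{f_{c,d}^{m+k}(0)-f_{c,d}^{m}(0)}{f_{c,d}^{m-1+k}(0)-f_{c,d}^{m-1}(0)}\right)^{\mu(n/k)}\in\mathbb{Q}(c),$$ the product being over the positive divisors $k$ of $n$, and for $m\ge 2$ and $n\ge 1$ set $$G_{d,m,n}(c)=\begin{cases}F_{d,m,n}(c) & \text{if } n\nmid m-1,\\ F_{d,m,n}(c)/F_{d,1,n}(c) & \text{if } n\mid m-1.\end{cases}$$ Then for every $m\ge 2$ the following rational functions are polynomials in $c$ with integer coefficients and are irreducible over $\mathbb{Q}$: $G_{d,m,1}(c)$ for every prime $d$, $G_{2,m,2}(c)$, and $G_{2,m,3}(c)$. -/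

import Mathlib

open Polynomial

noncomputable section

/-- The map `f_{c,d}(x) = x ^ d + c`, where the parameter `c` is the indeterminate of `ℚ(c)`. -/
def unicritical (d : ℕ) (x : RatFunc ℚ) : RatFunc ℚ := x ^ d + RatFunc.X

/-- The critical orbit `f_{c,d}^k(0)`, with `f_{c,d}^0(0) = 0`, as an element of `ℚ(c)`. -/
def critOrbit (d k : ℕ) : RatFunc ℚ := (unicritical d)^[k] 0

/-- The rational function
`F_{d,m,n}(c) = ∏_{k ∣ n} ((f^{m+k}(0) - f^m(0)) / (f^{m-1+k}(0) - f^{m-1}(0))) ^ μ(n/k)`,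
for `m ≥ 1` and `n ≥ 1`. For `d ≥ 2` all the differences that occur are nonzero. -/
def misiurewiczF (d m n : ℕ) : RatFunc ℚ :=
  ∏ k ∈ n.divisors,
    ((critOrbit d (m + k) - critOrbit d m) /
      (critOrbit d (m - 1 + k) - critOrbit d (m - 1))) ^ (ArithmeticFunction.moebius (n / k))

/-- `G_{d,m,n}(c)` for `m ≥ 2` and `n ≥ 1`, as an element of `ℚ(c)`. -/
def misiurewiczG (d m n : ℕ) : RatFunc ℚ :=
  if n ∣ m - 1 then misiurewiczF d m n / misiurewiczF d 1 n else misiurewiczF d m n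

/-- The rational function `g ∈ ℚ(c)` is a polynomial with integer coefficients that is irreducible
over `ℚ`. -/
def IsIrreducibleIntPoly (g : RatFunc ℚ) : Prop :=
  ∃ P : ℤ[X], algebraMap ℚ[X] (RatFunc ℚ) (P.map (Int.castRingHom ℚ)) = g ∧
    Irreducible (P.map (Int.castRingHom ℚ))

end

/-!
# Irreducibility of Misiurewicz polynomials of small period

Write `a_k = f^k(0)`, a monic polynomial in `ℤ[c]` for `k ≥ 1`. Each of the polynomials `G` satisfies
a generalized Eisenstein criterion (`irreducible_map_of_eq_pow_mod`) at a prime `p` and a monic `q`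
that is irreducible modulo `p`: modulo `p` it is a power of `q`, and modulo `q` it is `p` times
something not divisible by `q` modulo `p`.

The power of `q` comes from the congruence `a_{k+j} - a_k ≡ a_j ^ p ^ k` modulo `p` for `d = p`
(`map_orbitPoly_sub`). For `n = 1` it gives a power of `q = c`, and `G` takes the value `d` at `c = 0`.

For `d = 2` and `n` prime the factors are differences of squares and
`F_{2,s+1,n} = (a_{s+n} + a_s) / (a_{s+1} + a_s)`, which is `q ^ 2 ^ s` modulo `2` for `q = a_n / c`.
Modulo `q` the orbit of `0` has period `n`, and modulo `q ^ 2` it has period `n` from `a_1` on, since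
`0` is a critical point. So `F` modulo `q` (when `n ∤ s`) or modulo `q ^ 2` (when `n ∣ s`, so that `G`
is `F / q`) is an explicit polynomial that can be inspected for `n = 2` and `n = 3`.
-/

open Polynomial

noncomputable section

/-! ### The orbit polynomials -/

/-- The critical orbit `f^k(0)` of `x ^ d + c` as an element of `ℤ[c]`. -/
def orbitPoly (d k : ℕ) : ℤ[X] := (fun x => x ^ d + X)^[k] 0

lemma orbitPoly_zero (d : ℕ) : orbitPoly d 0 = 0 := rfl

lemma orbitPoly_succ (d k : ℕ) : orbitPoly d (k + 1) = orbitPoly d k ^ d + X := by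
  simp only [orbitPoly, Function.iterate_succ_apply']

lemma orbitPoly_one {d : ℕ} (hd : d ≠ 0) : orbitPoly d 1 = X := by
  simp [orbitPoly_succ, orbitPoly_zero, hd]

lemma orbitPoly_succ_sub (d i j : ℕ) :
    orbitPoly d (i + 1) - orbitPoly d (j + 1) = orbitPoly d i ^ d - orbitPoly d j ^ d := by
  rw [orbitPoly_succ, orbitPoly_succ]; ring

/-! ### An Eisenstein criterion -/

/-- A form of the generalized Eisenstein criterion: a monic integer polynomial that is a positive
power of an irreducible `q` modulo `p`, and of the form `q * A + p * r` with `q ∤ r` modulo `p`, is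
irreducible over `ℚ`. -/
lemma irreducible_map_of_eq_pow_mod {p : ℕ} [Fact p.Prime] {f q r A : ℤ[X]} {k : ℕ}
    (hq : q.Monic) (hq' : Irreducible (q.map (Int.castRingHom (ZMod p))))
    (hf : f.Monic) (hk : k ≠ 0)
    (hpow : f.map (Int.castRingHom (ZMod p)) = q.map (Int.castRingHom (ZMod p)) ^ k)
    (hfr : f = q * A + C (p : ℤ) * r)
    (hr : ¬ q.map (Int.castRingHom (ZMod p)) ∣ r.map (Int.castRingHom (ZMod p))) :
    Irreducible (f.map (Int.castRingHom ℚ)) := by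
  have hker : RingHom.ker (algebraMap ℤ (ZMod p)) ^ 2 = Ideal.span {(p : ℤ) ^ 2} := by
    rw [algebraMap_int_eq, ZMod.ker_intCastRingHom, Ideal.span_singleton_pow]
  rw [← IsPrimitive.Int.irreducible_iff_irreducible_map_cast hf.isPrimitive]
  refine generalizedEisenstein (K := ZMod p) (p := k) hq' hq hf.isPrimitive ?_ ?_ ?_ ?_
  · by_contra h0
    have h1 : f = 1 := hf.natDegree_eq_zero.mp (by omega)
    rw [h1, Polynomial.map_one] at hpow
    exact hq'.not_isUnit (isUnit_of_dvd_one (hpow ▸ dvd_pow_self _ hk))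
  · simp [hf.leadingCoeff]
  · simpa [hf.leadingCoeff] using hpow
  · intro h0
    apply hr
    have hmod : f %ₘ q = C (p : ℤ) * (r %ₘ q) := by
      rw [hfr, add_modByMonic, (modByMonic_eq_zero_iff_dvd hq).2 (dvd_mul_right q A), zero_add,
        ← smul_eq_C_mul, smul_modByMonic, smul_eq_C_mul]
    rw [← modByMonic_eq_zero_iff_dvd (hq.map _), ← map_modByMonic _ hq]
    ext n
    have hn := congrArg (fun g => coeff g n) h0
    simp only [hmod, coeff_map, coeff_C_mul, coeff_zero] at hn
    rw [Ideal.Quotient.eq_zero_iff_mem, hker, Ideal.mem_span_singleton, sq] at hn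
    have hp : (p : ℤ) ≠ 0 := by exact_mod_cast (Fact.out : p.Prime).ne_zero
    rw [coeff_map, coeff_zero, eq_intCast, ZMod.intCast_zmod_eq_zero_iff_dvd]
    exact (mul_dvd_mul_iff_left hp).1 hn

/-! ### The critical orbit: degrees, reduction modulo a prime, congruences -/

lemma orbitPoly_monic_natDegree {d : ℕ} (hd : 2 ≤ d) (k : ℕ) :
    (orbitPoly d (k + 1)).Monic ∧ (orbitPoly d (k + 1)).natDegree = d ^ k := by
  induction k with
  | zero => simp [orbitPoly_one (show d ≠ 0 by omega), monic_X]
  | succ k ih =>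
    have hdeg : (orbitPoly d (k + 1) ^ d).natDegree = d ^ (k + 1) := by
      rw [ih.1.natDegree_pow, ih.2, pow_succ']
    have hlt : (X : ℤ[X]).natDegree < (orbitPoly d (k + 1) ^ d).natDegree := by
      rw [hdeg, natDegree_X]; exact Nat.one_lt_pow (by omega) (by omega)
    rw [orbitPoly_succ d (k + 1)]
    exact ⟨(ih.1.pow d).add_of_left (degree_lt_degree hlt),
      by rw [natDegree_add_eq_left_of_natDegree_lt hlt, hdeg]⟩

lemma degree_orbitPoly_lt {d : ℕ} (hd : 2 ≤ d) {i j : ℕ} (h : j < i) :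
    (orbitPoly d j).degree < (orbitPoly d i).degree := by
  obtain ⟨i, rfl⟩ : ∃ i', i = i' + 1 := ⟨i - 1, by omega⟩
  have hi := orbitPoly_monic_natDegree hd i
  cases j with
  | zero =>
    rw [orbitPoly_zero, degree_zero, bot_lt_iff_ne_bot, Ne, degree_eq_bot]
    exact hi.1.ne_zero
  | succ j =>
    refine degree_lt_degree ?_
    rw [hi.2, (orbitPoly_monic_natDegree hd j).2]
    exact Nat.pow_lt_pow_right (by omega) (by omega)

lemma monic_orbitPoly_sub {d : ℕ} (hd : 2 ≤ d) {i j : ℕ} (h : j < i) :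
    (orbitPoly d i - orbitPoly d j).Monic := by
  have hlt := degree_orbitPoly_lt hd h
  obtain ⟨i, rfl⟩ : ∃ i', i = i' + 1 := ⟨i - 1, by omega⟩
  exact (orbitPoly_monic_natDegree hd i).1.sub_of_left hlt

lemma monic_orbitPoly_add {d : ℕ} (hd : 2 ≤ d) {i j : ℕ} (h : j < i) :
    (orbitPoly d i + orbitPoly d j).Monic := by
  have hlt := degree_orbitPoly_lt hd h
  obtain ⟨i, rfl⟩ : ∃ i', i = i' + 1 := ⟨i - 1, by omega⟩
  exact (orbitPoly_monic_natDegree hd i).1.add_of_left hlt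

/-- Modulo a prime `p`, the map `x ↦ x ^ p + c` is additive up to the translation by `c`. -/
lemma map_orbitPoly_sub (p : ℕ) [Fact p.Prime] (j k : ℕ) :
    (orbitPoly p (k + j) - orbitPoly p k).map (Int.castRingHom (ZMod p)) =
      (orbitPoly p j).map (Int.castRingHom (ZMod p)) ^ p ^ k := by
  induction k with
  | zero => simp [orbitPoly_zero]
  | succ k ih =>
    rw [show k + 1 + j = k + j + 1 by ring, orbitPoly_succ_sub, pow_succ, pow_mul, ← ih,
      Polynomial.map_sub, Polynomial.map_sub, Polynomial.map_pow, Polynomial.map_pow, sub_pow_char]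

lemma dvd_orbitPoly_sub_add {d i j : ℕ} {Q : ℤ[X]} (h : Q ∣ orbitPoly d i - orbitPoly d j) (k : ℕ) :
    Q ∣ orbitPoly d (i + k) - orbitPoly d (j + k) := by
  induction k with
  | zero => exact h
  | succ k ih =>
    rw [← add_assoc, ← add_assoc, orbitPoly_succ_sub]
    exact ih.trans (sub_dvd_pow_sub_pow _ _ d)

/-- If two terms of the orbit at distance `n` agree modulo `Q`, the orbit is periodic modulo `Q` from
there on. -/
lemma dvd_orbitPoly_sub_of_period {d s n : ℕ} {Q : ℤ[X]}
    (h : Q ∣ orbitPoly d (s + n) - orbitPoly d s) (j i : ℕ) :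
    Q ∣ orbitPoly d (s + n * j + i) - orbitPoly d (s + i) := by
  induction j with
  | zero => simp
  | succ j ih =>
    have h1 := dvd_add (dvd_orbitPoly_sub_add h (n * j + i)) ih
    rwa [show s + n + (n * j + i) = s + n * (j + 1) + i by ring,
      show s + (n * j + i) = s + n * j + i by ring, sub_add_sub_cancel] at h1

/-! ### Passage to rational functions -/

/-- The embedding of `ℤ[c]` in `ℚ(c)`. -/
def intPolyToRatFunc : ℤ[X] →+* RatFunc ℚ :=
  (algebraMap ℚ[X] (RatFunc ℚ)).comp (mapRingHom (Int.castRingHom ℚ))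

lemma intPolyToRatFunc_injective : Function.Injective intPolyToRatFunc :=
  (RatFunc.algebraMap_injective ℚ).comp (map_injective _ (RingHom.injective_int _))

lemma critOrbit_eq (d k : ℕ) : critOrbit d k = intPolyToRatFunc (orbitPoly d k) := by
  induction k with
  | zero => simp [critOrbit, orbitPoly_zero]
  | succ k ih =>
    have hX : intPolyToRatFunc X = RatFunc.X := by simp [intPolyToRatFunc]
    rw [orbitPoly_succ, map_add, map_pow, ← ih, hX, critOrbit, Function.iterate_succ_apply']
    rfl

lemma critOrbit_sub_ne_zero {d : ℕ} (hd : 2 ≤ d) {i j : ℕ} (h : j < i) :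
    critOrbit d i - critOrbit d j ≠ 0 := by
  rw [critOrbit_eq, critOrbit_eq, ← map_sub]
  exact (map_ne_zero_iff _ intPolyToRatFunc_injective).2 (monic_orbitPoly_sub hd h).ne_zero

lemma critOrbit_add_ne_zero {d : ℕ} (hd : 2 ≤ d) {i j : ℕ} (h : j < i) :
    critOrbit d i + critOrbit d j ≠ 0 := by
  rw [critOrbit_eq, critOrbit_eq, ← map_add]
  exact (map_ne_zero_iff _ intPolyToRatFunc_injective).2 (monic_orbitPoly_add hd h).ne_zero

lemma critOrbit_two_succ_sub (i j : ℕ) :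
    critOrbit 2 (i + 1) - critOrbit 2 (j + 1) =
      (critOrbit 2 i - critOrbit 2 j) * (critOrbit 2 i + critOrbit 2 j) := by
  simp only [critOrbit_eq, ← map_add, ← map_sub, ← map_mul, orbitPoly_succ_sub]
  congr 1; ring

lemma misiurewiczF_one (d s : ℕ) :
    misiurewiczF d (s + 1) 1 =
      (critOrbit d (s + 2) - critOrbit d (s + 1)) / (critOrbit d (s + 1) - critOrbit d s) := by
  simp [misiurewiczF]

/-- For `d = 2` and prime `n`, the differences of squares in `F_{2,m,n}` telescope. -/
lemma misiurewiczF_two_prime {n : ℕ} (hn : n.Prime) (s : ℕ) :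
    misiurewiczF 2 (s + 1) n =
      (critOrbit 2 (s + n) + critOrbit 2 s) / (critOrbit 2 (s + 1) + critOrbit 2 s) := by
  have h1 := critOrbit_sub_ne_zero le_rfl (show s < s + 1 by omega)
  have h2 := critOrbit_sub_ne_zero le_rfl (show s < s + n by have := hn.pos; omega)
  rw [misiurewiczF, hn.prod_divisors, Nat.div_self hn.pos, Nat.div_one,
    ArithmeticFunction.moebius_apply_one, ArithmeticFunction.moebius_apply_prime hn, zpow_one,
    zpow_neg_one, Nat.add_sub_cancel, show s + 1 + n = s + n + 1 by ring,
    critOrbit_two_succ_sub, critOrbit_two_succ_sub, mul_div_cancel_left₀ _ h1,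
    mul_div_cancel_left₀ _ h2, ← div_eq_mul_inv]

lemma isIrreducibleIntPoly_of_eq {g : RatFunc ℚ} {P : ℤ[X]} (h : intPolyToRatFunc P = g)
    (hP : Irreducible (P.map (Int.castRingHom ℚ))) : IsIrreducibleIntPoly g :=
  ⟨P, h, hP⟩

/-! ### Period one, prime degree -/

lemma exists_orbitPoly_eq_X_mul {d : ℕ} (hd : 2 ≤ d) (k : ℕ) :
    ∃ b : ℤ[X], orbitPoly d (k + 1) = X * b ∧ b.coeff 0 = 1 := by
  induction k with
  | zero => exact ⟨1, by rw [zero_add, orbitPoly_one (by omega), mul_one], by simp⟩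
  | succ k ih =>
    obtain ⟨b, hb, -⟩ := ih
    obtain ⟨e, rfl⟩ : ∃ e, d = e + 2 := ⟨d - 2, by omega⟩
    refine ⟨X * (X ^ e * b ^ (e + 2)) + 1, ?_, by rw [coeff_add, coeff_X_mul_zero]; simp⟩
    rw [orbitPoly_succ, hb]; ring

/-- `G_{d,m,1}` is Eisenstein at `d`: modulo `d` it is a power of `c`, and its value at `c = 0`
is `d`. -/
lemma isIrreducibleIntPoly_misiurewiczG_one {d : ℕ} (hd : d.Prime) {s : ℕ} (hs : s ≠ 0) :
    IsIrreducibleIntPoly (misiurewiczG d (s + 1) 1) := by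
  have := Fact.mk hd
  have hd2 := hd.two_le
  obtain ⟨t, rfl⟩ : ∃ t, s = t + 1 := ⟨s - 1, by omega⟩
  obtain ⟨b, hb, hb0⟩ := exists_orbitPoly_eq_X_mul hd2 (t + 1)
  obtain ⟨b', hb', hb0'⟩ := exists_orbitPoly_eq_X_mul hd2 t
  set G : ℤ[X] := ∑ i ∈ Finset.range d, b ^ i * b' ^ (d - 1 - i) with hG
  have hXd : (X : ℤ[X]) ^ (d - 1) * X = X ^ d := pow_sub_one_mul hd.ne_zero X
  have hmul : G * (X ^ (d - 1) * (orbitPoly d (t + 2) - orbitPoly d (t + 1))) =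
      orbitPoly d (t + 3) - orbitPoly d (t + 2) := by
    have h := geom_sum₂_mul b b' d
    rw [← hG] at h
    rw [orbitPoly_succ_sub d (t + 2) (t + 1), hb, hb', mul_pow, mul_pow, ← hXd]
    linear_combination X ^ (d - 1) * X * h
  refine isIrreducibleIntPoly_of_eq (P := G) ?_ ?_
  · have h1 := critOrbit_sub_ne_zero hd2 (show t + 1 < t + 2 by omega)
    have h2 := critOrbit_sub_ne_zero hd2 (show 0 < 1 by omega)
    have hX : critOrbit d 1 - critOrbit d 0 = intPolyToRatFunc X := by
      rw [critOrbit_eq, critOrbit_eq, ← map_sub, orbitPoly_zero, orbitPoly_one hd.ne_zero, sub_zero]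
    have hX2 : critOrbit d 2 - critOrbit d 1 = intPolyToRatFunc X ^ (d - 1) * intPolyToRatFunc X := by
      rw [critOrbit_eq, critOrbit_eq, ← map_sub, orbitPoly_succ_sub d 1 0, orbitPoly_zero,
        orbitPoly_one hd.ne_zero, zero_pow hd.ne_zero, sub_zero, ← hXd, map_mul, map_pow]
    have hM := congrArg intPolyToRatFunc hmul
    simp only [map_mul, map_sub, map_pow, ← critOrbit_eq] at hM
    rw [misiurewiczG, if_pos (one_dvd _), misiurewiczF_one, ← zero_add 1, misiurewiczF_one,
      zero_add, zero_add, hX2, hX]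
    rw [hX] at h2
    rw [mul_div_cancel_right₀ _ h2, div_div, eq_div_iff (mul_ne_zero h1 (pow_ne_zero _ h2)), ← hM]
    ring
  · have hq : (X : ℤ[X]).map (Int.castRingHom (ZMod d)) = X := map_X _
    -- The exponent `k` of `c` in `G` modulo `d` is positive because `d ^ (t + 2)` is at least
    -- `2 * d ^ (t + 1)`.
    obtain ⟨k, hk⟩ : ∃ k, d ^ (t + 2) = k + (d - 1 + d ^ (t + 1)) ∧ k ≠ 0 := by
      have h1 : d ≤ d ^ (t + 1) := Nat.le_self_pow (by omega) d
      have h2 : 2 * d ^ (t + 1) ≤ d ^ (t + 2) := by rw [pow_succ d (t + 1)]; nlinarith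
      exact ⟨d ^ (t + 2) - d ^ (t + 1) - (d - 1), by omega, by omega⟩
    have hred (i : ℕ) := map_orbitPoly_sub d 1 i
    simp only [orbitPoly_one hd.ne_zero, hq] at hred
    refine irreducible_map_of_eq_pow_mod (p := d) (q := X) (r := 1) (A := G.divX) (k := k)
      monic_X (by rw [hq]; exact irreducible_X) ?_ hk.2 ?_ ?_ ?_
    · refine Monic.of_mul_monic_right
        ((monic_X_pow (d - 1)).mul (monic_orbitPoly_sub hd2 (show t + 1 < t + 2 by omega))) ?_
      rw [hmul]
      exact monic_orbitPoly_sub hd2 (by omega)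
    · have hM := congrArg (Polynomial.map (Int.castRingHom (ZMod d))) hmul
      rw [Polynomial.map_mul, Polynomial.map_mul, hred (t + 1), hred (t + 2), Polynomial.map_pow,
        hq, hk.1, ← pow_add, pow_add X k] at hM
      rw [hq]
      exact mul_right_cancel₀ (pow_ne_zero _ X_ne_zero) hM
    · have h0 : G.coeff 0 = d := by
        simp [hG, coeff_zero_eq_eval_zero, eval_finsetSum] at hb0 hb0' ⊢
        simp [hb0, hb0']
      conv_lhs => rw [← X_mul_divX_add G, h0]
      rw [mul_one]
    · rw [hq, Polynomial.map_one]
      exact fun h => not_isUnit_X (isUnit_of_dvd_one h)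

/-! ### Prime period, degree two -/

/-- For `d = 2` and prime `n`, let `P = F_{2,s+1,n}` and `q = F_{2,1,n} = f^n(0) / c`. Modulo `2`,
`P` is `q ^ 2 ^ s`, so that irreducibility is decided by `P` modulo `q` and modulo `q ^ 2`. -/
lemma isIrreducibleIntPoly_misiurewiczG_two {n : ℕ} (hn : n.Prime) {s : ℕ} (hs : s ≠ 0) {P q : ℤ[X]}
    (hP : P * (orbitPoly 2 (s + 1) + orbitPoly 2 s) = orbitPoly 2 (s + n) + orbitPoly 2 s)
    (hq : X * q = orbitPoly 2 n) (hq' : Irreducible (q.map (Int.castRingHom (ZMod 2))))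
    (h1 : ¬ n ∣ s → ∃ A r : ℤ[X], P = q * A + 2 * r ∧
      ¬ q.map (Int.castRingHom (ZMod 2)) ∣ r.map (Int.castRingHom (ZMod 2)))
    (h2 : n ∣ s → ∃ A r : ℤ[X], P = q * (q * A + 2 * r) ∧
      ¬ q.map (Int.castRingHom (ZMod 2)) ∣ r.map (Int.castRingHom (ZMod 2))) :
    IsIrreducibleIntPoly (misiurewiczG 2 (s + 1) n) := by
  have hX : orbitPoly 2 1 = X := orbitPoly_one two_ne_zero
  have hn0 : n ≠ 0 := hn.ne_zero
  have hqm : q.Monic := by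
    refine monic_X.of_mul_monic_left ?_
    rw [hq]
    simpa [orbitPoly_zero] using monic_orbitPoly_sub le_rfl hn.pos
  have hPm : P.Monic := by
    refine (monic_orbitPoly_add le_rfl (show s < s + 1 by omega)).of_mul_monic_right ?_
    rw [hP]
    exact monic_orbitPoly_add le_rfl (by omega)
  have hpow : P.map (Int.castRingHom (ZMod 2)) = q.map (Int.castRingHom (ZMod 2)) ^ 2 ^ s := by
    have hred (j : ℕ) := map_orbitPoly_sub 2 j s
    simp only [Polynomial.map_sub, CharTwo.sub_eq_add, ← Polynomial.map_add] at hred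
    have hM := congrArg (Polynomial.map (Int.castRingHom (ZMod 2))) hP
    rw [Polynomial.map_mul, hred, hred, ← hq, hX, Polynomial.map_mul, mul_pow, mul_comm, map_X] at hM
    exact mul_left_cancel₀ (pow_ne_zero _ X_ne_zero) hM
  have hF : intPolyToRatFunc P = misiurewiczF 2 (s + 1) n := by
    rw [misiurewiczF_two_prime hn, eq_div_iff (critOrbit_add_ne_zero le_rfl (by omega))]
    simp only [critOrbit_eq, ← map_add, ← map_mul, hP]
  have hC : C ((2 : ℕ) : ℤ) = (2 : ℤ[X]) := by simp
  by_cases hd : n ∣ s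
  · obtain ⟨A, r, hG, hr⟩ := h2 hd
    refine isIrreducibleIntPoly_of_eq (P := q * A + 2 * r) ?_ ?_
    · have hF1 : misiurewiczF 2 1 n = intPolyToRatFunc q := by
        rw [← zero_add 1, misiurewiczF_two_prime hn, zero_add, zero_add, critOrbit_eq, critOrbit_eq,
          critOrbit_eq, orbitPoly_zero, hX, ← hq, map_zero, add_zero, add_zero, map_mul,
          mul_div_cancel_left₀]
        exact (map_ne_zero_iff _ intPolyToRatFunc_injective).2 X_ne_zero
      rw [misiurewiczG, if_pos (by simpa using hd), hF1, ← hF, hG, map_mul, mul_div_cancel_left₀]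
      exact (map_ne_zero_iff _ intPolyToRatFunc_injective).2 hqm.ne_zero
    · have hs2 : 2 ≤ 2 ^ s := Nat.le_self_pow hs 2
      refine irreducible_map_of_eq_pow_mod (p := 2) (k := 2 ^ s - 1) hqm hq'
        (hqm.of_mul_monic_left (hG ▸ hPm)) (by omega) ?_ (by rw [hC]) hr
      rw [hG, Polynomial.map_mul, ← mul_pow_sub_one (show 2 ^ s ≠ 0 by omega)] at hpow
      exact mul_left_cancel₀ hq'.ne_zero hpow
  · obtain ⟨A, r, hPr, hr⟩ := h1 hd
    refine isIrreducibleIntPoly_of_eq (P := P) ?_ ?_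
    · rw [misiurewiczG, if_neg (by simpa using hd), hF]
    · exact irreducible_map_of_eq_pow_mod (p := 2) hqm hq' hPm (by positivity) hpow
        (by rw [hC]; exact hPr) hr

lemma orbitPoly_two_two : orbitPoly 2 2 = X ^ 2 + X := by
  rw [orbitPoly_succ, orbitPoly_one two_ne_zero]

lemma orbitPoly_two_three : orbitPoly 2 3 = (X ^ 2 + X) ^ 2 + X := by
  rw [orbitPoly_succ, orbitPoly_two_two]

/-- If `c * q = f^n(0)` with `f = x ^ 2 + c`, then `0` has period `n` modulo `q`. -/
lemma dvd_orbitPoly_two_sub {n : ℕ} {q : ℤ[X]} (hq : X * q = orbitPoly 2 n) (j i : ℕ) :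
    q ∣ orbitPoly 2 (n * j + i) - orbitPoly 2 i := by
  have h := dvd_orbitPoly_sub_of_period (d := 2) (s := 0) (n := n) (Q := q)
    (by rw [zero_add, orbitPoly_zero, sub_zero, ← hq]; exact dvd_mul_left q X) j i
  simpa using h

/-- Since `0` is a critical point of `f = x ^ 2 + c`, the orbit is periodic even modulo `q ^ 2`
from `f(0)` on. -/
lemma sq_dvd_orbitPoly_two_sub {n : ℕ} {q : ℤ[X]} (hq : X * q = orbitPoly 2 n) (j i : ℕ) :
    q ^ 2 ∣ orbitPoly 2 (1 + n * j + i) - orbitPoly 2 (1 + i) := by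
  refine dvd_orbitPoly_sub_of_period ⟨X ^ 2, ?_⟩ j i
  rw [add_comm 1 n, orbitPoly_succ, ← hq, orbitPoly_one two_ne_zero]
  ring

lemma isIrreducibleIntPoly_misiurewiczG_two_two {s : ℕ} (hs : s ≠ 0) :
    IsIrreducibleIntPoly (misiurewiczG 2 (s + 1) 2) := by
  have hX : orbitPoly 2 1 = X := orbitPoly_one two_ne_zero
  have hq : X * (X + 1) = orbitPoly 2 2 := by rw [orbitPoly_two_two]; ring
  have hirr : Irreducible ((X + 1 : ℤ[X]).map (Int.castRingHom (ZMod 2))) := by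
    have h := irreducible_X_sub_C (-1 : ZMod 2)
    rw [C_neg, C_1, sub_neg_eq_add] at h
    rwa [Polynomial.map_add, map_X, Polynomial.map_one]
  have hr : ¬ (X + 1 : ℤ[X]).map (Int.castRingHom (ZMod 2)) ∣
      (1 : ℤ[X]).map (Int.castRingHom (ZMod 2)) := by
    rw [Polynomial.map_one]
    exact fun h => hirr.not_isUnit (isUnit_of_dvd_one h)
  -- `(a ^ 2 + c + b) / (a + b) = a - b + 1` for `a = b ^ 2 + c`.
  refine isIrreducibleIntPoly_misiurewiczG_two Nat.prime_two hs
    (P := orbitPoly 2 (s + 1) - orbitPoly 2 s + 1) ?_ hq hirr ?_ ?_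
  · rw [orbitPoly_succ 2 (s + 1), orbitPoly_succ 2 s]
    ring
  · intro h
    obtain ⟨j, rfl⟩ : ∃ j, s = 2 * j + 1 := ⟨s / 2, by omega⟩
    obtain ⟨u, hu⟩ := dvd_orbitPoly_two_sub hq j 1
    obtain ⟨v, hv⟩ := dvd_orbitPoly_two_sub hq j 2
    rw [hX] at hu
    rw [orbitPoly_two_two] at hv
    exact ⟨v - u + X - 1, 1, by linear_combination hv - hu, hr⟩
  · intro h
    obtain ⟨j, rfl⟩ : ∃ j, s = 1 + 2 * j + 1 := ⟨s / 2 - 1, by omega⟩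
    obtain ⟨u, hu⟩ := sq_dvd_orbitPoly_two_sub hq j 1
    obtain ⟨v, hv⟩ := sq_dvd_orbitPoly_two_sub hq (j + 1) 0
    rw [show 1 + 1 = 2 by rfl, orbitPoly_two_two] at hu
    rw [show 1 + 2 * (j + 1) + 0 = 1 + 2 * j + 1 + 1 by ring, add_zero, hX] at hv
    exact ⟨v - u - 1, 1, by linear_combination hv - hu, hr⟩

lemma isIrreducibleIntPoly_misiurewiczG_two_three {s : ℕ} (hs : s ≠ 0) :
    IsIrreducibleIntPoly (misiurewiczG 2 (s + 1) 3) := by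
  have hX : orbitPoly 2 1 = X := orbitPoly_one two_ne_zero
  have hq : X * (X ^ 3 + 2 * X ^ 2 + X + 1) = orbitPoly 2 3 := by rw [orbitPoly_two_three]; ring
  have hmap : (X ^ 3 + 2 * X ^ 2 + X + 1 : ℤ[X]).map (Int.castRingHom (ZMod 2)) = X ^ 3 + X + 1 := by
    have h2 : (2 : (ZMod 2)[X]) = 0 := CharTwo.two_eq_zero
    simp [h2]
  have hdeg : (X ^ 3 + X + 1 : (ZMod 2)[X]).natDegree = 3 := by compute_degree!
  have hmonic : (X ^ 3 + X + 1 : (ZMod 2)[X]).Monic := by monicity!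
  have hirr : Irreducible ((X ^ 3 + 2 * X ^ 2 + X + 1 : ℤ[X]).map (Int.castRingHom (ZMod 2))) := by
    rw [hmap]
    refine irreducible_of_degree_le_three_of_not_isRoot (by rw [hdeg]; decide) fun x => ?_
    simp only [IsRoot, eval_add, eval_pow, eval_X, eval_one]
    revert x
    decide
  have hr : ¬ (X ^ 3 + 2 * X ^ 2 + X + 1 : ℤ[X]).map (Int.castRingHom (ZMod 2)) ∣
      (1 : ℤ[X]).map (Int.castRingHom (ZMod 2)) := by
    rw [Polynomial.map_one]
    exact fun h => hirr.not_isUnit (isUnit_of_dvd_one h)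
  -- From `a_{s+3} + a_s = (a_{s+2} ^ 2 - a_s ^ 2) + (a_{s+1} + a_s)` and
  -- `a_{s+2} + a_s = (a_{s+1} + a_s) * (a_{s+1} - a_s + 1)`, where `a_k = f^k(0)`.
  refine isIrreducibleIntPoly_misiurewiczG_two Nat.prime_three hs
    (P := 1 + (orbitPoly 2 (s + 2) - orbitPoly 2 s) * (orbitPoly 2 (s + 1) - orbitPoly 2 s + 1))
    ?_ hq hirr ?_ ?_
  · rw [orbitPoly_succ 2 (s + 2), orbitPoly_succ 2 (s + 1), orbitPoly_succ 2 s]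
    ring
  · intro h
    obtain h3 | h3 : s % 3 = 1 ∨ s % 3 = 2 := by omega
    · obtain ⟨j, rfl⟩ : ∃ j, s = 3 * j + 1 := ⟨s / 3, by omega⟩
      obtain ⟨u, hu⟩ := dvd_orbitPoly_two_sub hq j 1
      obtain ⟨v, hv⟩ := dvd_orbitPoly_two_sub hq j 2
      obtain ⟨w, hw⟩ := dvd_orbitPoly_two_sub hq j 3
      rw [hX, sub_eq_iff_eq_add] at hu
      rw [orbitPoly_two_two, sub_eq_iff_eq_add] at hv
      rw [← hq, sub_eq_iff_eq_add] at hw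
      refine ⟨(w + X - u) * (X ^ 2 + 1) - X * (v - u)
        + (X ^ 3 + 2 * X ^ 2 + X + 1) * (w + X - u) * (v - u) - 1, X ^ 2 + 1, ?_, ?_⟩
      · rw [show 3 * j + 1 + 2 = 3 * j + 3 by ring, show 3 * j + 1 + 1 = 3 * j + 2 by ring,
          hu, hv, hw]
        ring
      · rw [hmap]
        have hm : (X ^ 2 + 1 : (ZMod 2)[X]).Monic := by monicity!
        have hd : (X ^ 2 + 1 : (ZMod 2)[X]).natDegree = 2 := by compute_degree!
        simpa using hmonic.not_dvd_of_natDegree_lt hm.ne_zero (by omega)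
    · obtain ⟨j, rfl⟩ : ∃ j, s = 3 * j + 2 := ⟨s / 3, by omega⟩
      obtain ⟨u, hu⟩ := dvd_orbitPoly_two_sub hq j 2
      obtain ⟨v, hv⟩ := dvd_orbitPoly_two_sub hq j 3
      obtain ⟨w, hw⟩ := dvd_orbitPoly_two_sub hq (j + 1) 1
      rw [orbitPoly_two_two, sub_eq_iff_eq_add] at hu
      rw [← hq, sub_eq_iff_eq_add] at hv
      rw [hX, sub_eq_iff_eq_add] at hw
      refine ⟨(w - u) * (1 - X - X ^ 2) - X ^ 2 * (v + X - u)
        + (X ^ 3 + 2 * X ^ 2 + X + 1) * (w - u) * (v + X - u) + X - 1, 1, ?_, hr⟩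
      rw [show 3 * j + 2 + 2 = 3 * (j + 1) + 1 by ring, show 3 * j + 2 + 1 = 3 * j + 3 by ring,
        hu, hv, hw]
      ring
  · intro h
    obtain ⟨j, rfl⟩ : ∃ j, s = 1 + 3 * j + 2 := ⟨s / 3 - 1, by omega⟩
    obtain ⟨u, hu⟩ := sq_dvd_orbitPoly_two_sub hq j 2
    obtain ⟨v, hv⟩ := sq_dvd_orbitPoly_two_sub hq (j + 1) 0
    obtain ⟨w, hw⟩ := sq_dvd_orbitPoly_two_sub hq (j + 1) 1
    rw [show 1 + 2 = 3 by rfl, ← hq, sub_eq_iff_eq_add] at hu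
    rw [show 1 + 3 * (j + 1) + 0 = 1 + 3 * j + 2 + 1 by ring, add_zero, hX,
      sub_eq_iff_eq_add] at hv
    rw [show 1 + 3 * (j + 1) + 1 = 1 + 3 * j + 2 + 2 by ring, show 1 + 1 = 2 by rfl,
      orbitPoly_two_two, sub_eq_iff_eq_add] at hw
    refine ⟨X ^ 2 - 1 + (w - u) * (X + 1 - X * (X ^ 3 + 2 * X ^ 2 + X + 1))
      + (v - u) * (X ^ 2 + X - X * (X ^ 3 + 2 * X ^ 2 + X + 1))
      + (X ^ 3 + 2 * X ^ 2 + X + 1) ^ 2 * (w - u) * (v - u), 1, ?_, hr⟩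
    rw [hu, hv, hw]
    ring

end

theorem corollary1p5 (m : ℕ) (hm : 2 ≤ m) :
    (∀ d : ℕ, d.Prime → IsIrreducibleIntPoly (misiurewiczG d m 1)) ∧
      IsIrreducibleIntPoly (misiurewiczG 2 m 2) ∧
      IsIrreducibleIntPoly (misiurewiczG 2 m 3) := by
  obtain ⟨s, rfl⟩ : ∃ s, m = s + 1 := ⟨m - 1, by omega⟩
  have hs : s ≠ 0 := by omega
  exact ⟨fun d hd => isIrreducibleIntPoly_misiurewiczG_one hd hs,
    isIrreducibleIntPoly_misiurewiczG_two_two hs, isIrreducibleIntPoly_misiurewiczG_two_three hs⟩
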